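/- \textbf{Theorem (smooth $k$-forms).} Let $(M,g_M)$ and $(N,g_N)$ be oriented smooth Riemannian $n$-manifolds (Hausdorff, second countable, without boundary), with Riemannian volume forms $\mu_M$ and $\mu_N$, and let $\varphi\colon M\to N$ be an orientation-preserving diffeomorphism. For $x\in M$ let $\alpha_1(x)\ge\dots\ge\alpha_n(x)>0$ be the singular values of the tangent map $T_x\varphi\colon (T_xM,g_M)\to (T_{\varphi(x)}N,g_N)$. For a $k$-form $\omega$, let $$|\omega|(x)=\sup_{0\ne X_1,\dots,X_k\in T_xM}\frac{|\omega(X_1,\dots,X_k)|}{|X_1|\cdots|X_k|}$$ be its pointwise spectral norm, and let $\|\omega\|_p$ be the $L^p$-norm of the function $|\omega|$ with respect to the Riemannian volume, that is, $\bigl(\int_M|\omega|^p\mu_M\bigr)^{1/p}$ for $1\le p<\infty$ and the essential supremum of $|\omega|$ for $p=\infty$; norms of functions on $M$ and of forms on $N$ are defined likewise. Let $\varphi_*\omega=(\varphi^{-1})^*\omega$, let $\operatorname{supp}\omega$ be the closure of $\{x:\omega_x\neq 0\}$, and let $\mathbf 1_{\operatorname{supp}\omega}$ be its indicator function. Then for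 every $k\in\{0,\dots,n\}$, every smooth $k$-form $\omega$ on $M$ with compact support, and all $p,q\in[1,\infty]$ with $1/p+1/q=1$ (where $1/\infty=0$), $$\bigl\|\mathbf 1_{\operatorname{supp}\omega}(\alpha_1\cdots\alpha_k)^{1/q}(\alpha_{k+1}\cdots\alpha_n)^{-1/p}\bigr\|_\infty^{-1}\,\|\omega\|_p\;\le\;\|\varphi_*\omega\|_p\;\le\;\bigl\|\mathbf 1_{\operatorname{supp}\omega}(\alpha_1\cdots\alpha_{n-k})^{1/p}(\alpha_{n-k+1}\cdots\alpha_n)^{-1/q}\bigr\|_\infty\,\|\omega\|_p .$$ Empty products are $1$, and if $\omega=0$ the left-hand side is read as $0$. -/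

import Mathlib

open Set MeasureTheory Bundle Manifold
open scoped ENNReal ContDiff Topology

noncomputable section

attribute [local instance 2000] chartedSpaceSelf

/-- A `k`-form on an `n`-dimensional manifold, with no regularity imposed: an alternating
`k`-linear form on each tangent space. -/
abbrev KForm (n k : ℕ) (M : Type*) [TopologicalSpace M] [ChartedSpace (EuclideanSpace ℝ (Fin n)) M] :
    Type _ :=
  (x : M) → TangentSpace (𝓡 n) x [⋀^Fin k]→L[ℝ] ℝ

section

variable {n k : ℕ} {M : Type*} [TopologicalSpace M] [ChartedSpace (EuclideanSpace ℝ (Fin n)) M]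

/-- The expression of a `k`-form in the chart at `x₀`, that is, its pullback under the inverse of
that chart, which is a `k`-form on the target of the chart. -/
def KForm.inChart (η : KForm n k M) (x₀ : M) (y : EuclideanSpace ℝ (Fin n)) :
    EuclideanSpace ℝ (Fin n) [⋀^Fin k]→L[ℝ] ℝ :=
  (η ((chartAt (EuclideanSpace ℝ (Fin n)) x₀).symm y)).compContinuousLinearMap
    (mfderiv (𝓡 n) (𝓡 n) (chartAt (EuclideanSpace ℝ (Fin n)) x₀).symm y)

/-- A `k`-form is smooth if its expression in each chart is smooth. -/
def KForm.IsSmooth (η : KForm n k M) : Prop :=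
  ∀ x₀ : M, ContDiffOn ℝ ∞ (η.inChart x₀) (chartAt (EuclideanSpace ℝ (Fin n)) x₀).target

/-- The support of a `k`-form: the closure of the set of points where it does not vanish. -/
def KForm.support (η : KForm n k M) : Set M := closure {x | η x ≠ 0}

/-- The pushforward `φ_* η = (φ⁻¹)^* η` of a `k`-form under a diffeomorphism. -/
def KForm.pushforward {N : Type*} [TopologicalSpace N] [ChartedSpace (EuclideanSpace ℝ (Fin n)) N]
    (φ : M ≃ₘ⟮𝓡 n, 𝓡 n⟯ N) (η : KForm n k M) : KForm n k N :=
  fun y ↦ (η (φ.symm y)).compContinuousLinearMap (mfderiv (𝓡 n) (𝓡 n) φ.symm y)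

end

/-- An orientation of an `n`-dimensional smooth manifold: an orientation of each tangent space,
such that near each point `x₀` it is locally constant when the tangent spaces are identified with
`ℝⁿ` by the trivialization of the tangent bundle given by the chart at `x₀`. -/
structure ManifoldOrientation (n : ℕ) (M : Type*) [TopologicalSpace M]
    [ChartedSpace (EuclideanSpace ℝ (Fin n)) M] [IsManifold (𝓡 n) ∞ M] where
  orientAt : (x : M) → Orientation ℝ (TangentSpace (𝓡 n) x) (Fin n)
  locally_constant : ∀ x₀ : M, ∃ o : Orientation ℝ (EuclideanSpace ℝ (Fin n)) (Fin n),
    ∀ᶠ x in 𝓝 x₀, ∀ hx : x ∈ (trivializationAt (EuclideanSpace ℝ (Fin n))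
        (TangentSpace (𝓡 n) : M → Type _) x₀).baseSet,
      Orientation.map (Fin n) ((trivializationAt (EuclideanSpace ℝ (Fin n))
        (TangentSpace (𝓡 n) : M → Type _) x₀).linearEquivAt ℝ x hx) (orientAt x) = o

/-- A diffeomorphism is orientation-preserving if its tangent map at each point carries the
orientation of the source to the orientation of the target. -/
def IsOrientationPreserving {n : ℕ}
    {M : Type*} [TopologicalSpace M] [ChartedSpace (EuclideanSpace ℝ (Fin n)) M]
    [IsManifold (𝓡 n) ∞ M]
    {N : Type*} [TopologicalSpace N] [ChartedSpace (EuclideanSpace ℝ (Fin n)) N]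
    [IsManifold (𝓡 n) ∞ N]
    (oM : ManifoldOrientation n M) (oN : ManifoldOrientation n N) (φ : M ≃ₘ⟮𝓡 n, 𝓡 n⟯ N) : Prop :=
  ∀ x : M, Orientation.map (Fin n)
    (φ.mfderivToContinuousLinearEquiv (by simp) x).toLinearEquiv (oM.orientAt x) = oN.orientAt (φ x)

section

variable {n k : ℕ} {M : Type*} [TopologicalSpace M] [ChartedSpace (EuclideanSpace ℝ (Fin n)) M]
  [RiemannianBundle (fun x : M ↦ TangentSpace (𝓡 n) x)]

/-- The density `√(det g_ij)` of the Riemannian volume in the chart at `x₀`, where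
`g_ij = g(∂_i, ∂_j)` is the Gram matrix of the coordinate vector fields. -/
def riemannianDensity (x₀ : M) (y : EuclideanSpace ℝ (Fin n)) : ℝ :=
  √(Matrix.gram ℝ fun i : Fin n ↦
    (mfderiv (𝓡 n) (𝓡 n) (chartAt (EuclideanSpace ℝ (Fin n)) x₀).symm y
      (EuclideanSpace.basisFun (Fin n) ℝ i) :
      TangentSpace (𝓡 n) ((chartAt (EuclideanSpace ℝ (Fin n)) x₀).symm y))).det

/-- The Riemannian volume of the domain of the chart at `x₀`, as a measure on `M` that vanishes
outside this domain: the measure `√(det g_ij) dy` on the target of the chart, carried to `M`. -/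
def chartVolume [MeasurableSpace M] (x₀ : M) : Measure M :=
  (((volume : Measure (EuclideanSpace ℝ (Fin n))).restrict
    (chartAt (EuclideanSpace ℝ (Fin n)) x₀).target).withDensity
      fun y ↦ ENNReal.ofReal (riemannianDensity x₀ y)).map
    (chartAt (EuclideanSpace ℝ (Fin n)) x₀).symm

variable (n M) in
/-- The Riemannian volume measure of `M`, against which the volume form `μ_M` integrates functions:
the least measure that dominates `√(det g_ij) dy` in every chart. As these measures agree on
overlaps of charts, it is the measure that restricts to `√(det g_ij) dy` on the domain of every chart. -/
def riemannianVolume [MeasurableSpace M] : Measure M :=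
  ⨆ x₀ : M, chartVolume (n := n) x₀

/-- The spectral norm of the `k`-form `η` at `x`: the norm of `η x` as a multilinear form on the
tangent space with its Riemannian norm, that is, the least `C ≥ 0` such that
`|η x (X₁, …, X_k)| ≤ C |X₁| ⋯ |X_k|` for all tangent vectors at `x`. -/
def KForm.spectralNorm (η : KForm n k M) (x : M) : ℝ := ‖η x‖

/-- The `L^p` norm of a `k`-form: the `L^p` norm of its pointwise spectral norm with respect to the
Riemannian volume (the essential supremum if `p = ∞`). -/
def KForm.lpNorm [MeasurableSpace M] (η : KForm n k M) (p : ℝ≥0∞) : ℝ≥0∞ :=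
  eLpNorm η.spectralNorm p (riemannianVolume n M)

/-- The `L^∞` norm of the product of the indicator function of `s` and the function `f`. -/
def supNormOn (n : ℕ) {M : Type*} [TopologicalSpace M] [ChartedSpace (EuclideanSpace ℝ (Fin n)) M]
    [RiemannianBundle (fun x : M ↦ TangentSpace (𝓡 n) x)] [MeasurableSpace M]
    (s : Set M) (f : M → ℝ) : ℝ≥0∞ :=
  eLpNorm (s.indicator f) ∞ (riemannianVolume n M)

/-- `singularValue φ x i` for `i < n` are the `n` singular values, in decreasing order, of the
tangent map of `φ` at `x` between the tangent spaces with their Riemannian inner products.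
The index starts at `0`, so `α_i(x)` is `singularValue φ x (i - 1)`. -/
def singularValue {N : Type*} [TopologicalSpace N] [ChartedSpace (EuclideanSpace ℝ (Fin n)) N]
    [RiemannianBundle (fun y : N ↦ TangentSpace (𝓡 n) y)]
    (φ : M ≃ₘ⟮𝓡 n, 𝓡 n⟯ N) (x : M) (i : ℕ) : ℝ :=
  haveI : FiniteDimensional ℝ (TangentSpace (𝓡 n) x) :=
    inferInstanceAs (FiniteDimensional ℝ (EuclideanSpace ℝ (Fin n)))
  haveI : FiniteDimensional ℝ (TangentSpace (𝓡 n) (φ x)) :=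
    inferInstanceAs (FiniteDimensional ℝ (EuclideanSpace ℝ (Fin n)))
  (mfderiv (𝓡 n) (𝓡 n) φ x).toLinearMap.singularValues i

end

end

/-!
Fix a point `x`, put `T = T_x φ` and let `α₁ ≥ … ≥ αₙ > 0` be its singular values. If `S` is a linear
map with singular values `s₁ ≥ s₂ ≥ …` and `ω` is an alternating `k`-form, then
`‖S^* ω‖ ≤ s₁ ⋯ s_k ‖ω‖` (`norm_compContinuousLinearMap_le_prod`). Indeed, every `k`-dimensional
subspace has an orthonormal basis `b` with `‖S bᵢ‖ ≤ sᵢ` up to the order of the indices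
(`exists_orthonormal_norm_map_le`), so that `|S^* ω (b₁, …, b_k)| ≤ s₁ ⋯ s_k ‖ω‖`, and by Hadamard's
inequality (`abs_alternatingMap_le`) the value of `S^* ω` at arbitrary vectors `X₁, …, X_k` of this
subspace is at most its value at `b` times `‖X₁‖ ⋯ ‖X_k‖`. For `S = T` and `S = T⁻¹` this gives
the pointwise estimates
`|η| ≤ α₁ ⋯ α_k · |φ_* η| ∘ φ` and `|φ_* η| ∘ φ ≤ (α_{n-k+1} ⋯ αₙ)⁻¹ · |η|`.

The volume of `N` is the image under `φ` of `J μ_M` with `J = α₁ ⋯ αₙ`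
(`riemannianVolume_eq_map_withDensity`), so `‖φ_* η‖_p` is the `L^p` norm on `M` of
`J^{1/p} · |φ_* η| ∘ φ`. Multiplying the pointwise estimates by the appropriate power of `J`, and using
`1/p + 1/q = 1`, turns the factors above into the weights of the theorem, which are bounded by their
essential supremum on the support of `η`. This supremum is finite, since the singular values and
their inverses are locally bounded (`exists_singularValue_bound`) and the support is compact.

The change of variables formula is proved in charts. There the density `√(det g_ij)` is the norm
determinant of the derivative of the inverse chart, and norm determinants are multiplicative under
composition. The case of the identity map shows that the measures `√(det g_ij) dy` of different
charts agree on overlaps, so that the supremum defining the Riemannian volume restricts to each of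
them.
-/

noncomputable section

attribute [local instance 2000] chartedSpaceSelf

/-! ### Pullback of alternating forms and singular values -/

section LinearAlgebra

open Module
open scoped RealInnerProductSpace

section Bound

variable {V W : Type*} [NormedAddCommGroup V] [InnerProductSpace ℝ V]
  [NormedAddCommGroup W] [NormedSpace ℝ W]

/-- The max-min principle for singular values, in the form of an adapted orthonormal family. The
numbers `s j` stand for the singular values of `S` in decreasing order, and the `f i` for the
corresponding right singular vectors. -/
theorem exists_orthonormal_norm_map_le {S : V →ₗ[ℝ] W} {s : ℕ → ℝ} {f : ℕ → V}
    {k : ℕ} (hS : ∀ j < k, ∀ v : V, (∀ i < j, ⟪f i, v⟫ = 0) → ‖S v‖ ≤ s j * ‖v‖)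
    (U : Submodule ℝ V) [FiniteDimensional ℝ U] (hU : finrank ℝ U = k) :
    ∃ b : Fin k → V, Orthonormal ℝ b ∧ (∀ i, b i ∈ U) ∧ ∀ i, ‖S (b i)‖ ≤ s i.rev := by
  induction k generalizing U with
  | zero => exact ⟨Fin.elim0, by simp, fun i ↦ i.elim0, fun i ↦ i.elim0⟩
  | succ k ih =>
    -- By a dimension count, `U` contains a unit vector orthogonal to `f 0, …, f (k - 1)`.
    let g : U →ₗ[ℝ] (Fin k → ℝ) :=
      LinearMap.pi fun i ↦ (innerSL ℝ (f i)).toLinearMap ∘ₗ U.subtype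
    have hker : g.ker ≠ ⊥ := LinearMap.ker_ne_bot_of_finrank_lt (by simp [hU])
    obtain ⟨u, hu, hu0⟩ := (Submodule.ne_bot_iff _).mp hker
    have hu0' : ‖(u : V)‖ ≠ 0 := by simpa using hu0
    set w : V := ‖(u : V)‖⁻¹ • (u : V) with hw
    have hwU : w ∈ U := U.smul_mem _ u.2
    have hw1 : ‖w‖ = 1 := by
      rw [hw, norm_smul, norm_inv, norm_norm, inv_mul_cancel₀ hu0']
    have hwf : ∀ i < k, ⟪f i, w⟫ = 0 := by
      intro i hi
      have := congrFun (LinearMap.mem_ker.mp hu) ⟨i, hi⟩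
      have h2 : ⟪f i, (u : V)⟫ = 0 := by simpa [g] using this
      rw [hw, inner_smul_right, h2, mul_zero]
    have hle : Submodule.span ℝ {w} ≤ U := by simpa using hwU
    have hdim := Submodule.finrank_add_inf_finrank_orthogonal hle
    rw [finrank_span_singleton (by rintro h; simp [h] at hw1), hU] at hdim
    have : FiniteDimensional ℝ ↥((Submodule.span ℝ {w})ᗮ ⊓ U) :=
      Submodule.finiteDimensional_of_le inf_le_right
    obtain ⟨b, hb, hbU, hbs⟩ := ih (fun j hj ↦ hS j (hj.trans k.lt_succ_self))
      ((Submodule.span ℝ {w})ᗮ ⊓ U) (by omega)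
    refine ⟨Matrix.vecCons w b, ?_, ?_, ?_⟩
    · rw [orthonormal_vecCons_iff]
      exact ⟨hw1, fun i ↦ Submodule.mem_orthogonal_singleton_iff_inner_right.mp (hbU i).1, hb⟩
    · exact Fin.cases hwU fun i ↦ (hbU i).2
    · refine Fin.cases ?_ fun i ↦ ?_
      · simpa [hw1] using hS k k.lt_succ_self w hwf
      · simpa [Fin.rev_succ] using hbs i

/-- Hadamard's inequality: an alternating `k`-form on a `k`-dimensional space is bounded by its
value on an orthonormal basis. -/
theorem abs_alternatingMap_le {k : ℕ} {U : Type*} [NormedAddCommGroup U] [InnerProductSpace ℝ U]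
    (b : OrthonormalBasis (Fin k) ℝ U) (g : U [⋀^Fin k]→ₗ[ℝ] ℝ) (X : Fin k → U) :
    |g X| ≤ |g b| * ∏ i, ‖X i‖ := by
  have : Fact (finrank ℝ U = k) := ⟨by simpa using finrank_eq_card_basis b.toBasis⟩
  have h := AlternatingMap.eq_smul_basis_det b.toBasis g
  rw [h, AlternatingMap.smul_apply, smul_eq_mul, abs_mul, b.coe_toBasis]
  have hv := b.toBasis.orientation.abs_volumeForm_apply_le X
  rw [Orientation.volumeForm_robust _ b rfl] at hv
  have h1 : b.toBasis.det b = 1 := by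
    rw [← b.coe_toBasis]; exact b.toBasis.det_self
  rw [AlternatingMap.smul_apply, smul_eq_mul, h1, mul_one]
  gcongr

/-- The pullback of a `k`-form under a linear map expands the spectral norm at most by the product
of the `k` largest singular values. -/
theorem norm_compContinuousLinearMap_le_prod {S : V →L[ℝ] W} {s : ℕ → ℝ} {f : ℕ → V} {k : ℕ}
    (hs : ∀ j < k, 0 ≤ s j)
    (hS : ∀ j < k, ∀ v : V, (∀ i < j, ⟪f i, v⟫ = 0) → ‖S v‖ ≤ s j * ‖v‖)
    (η : W [⋀^Fin k]→L[ℝ] ℝ) :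
    ‖η.compContinuousLinearMap S‖ ≤ (∏ i ∈ Finset.range k, s i) * ‖η‖ := by
  have hprod : 0 ≤ ∏ i ∈ Finset.range k, s i :=
    Finset.prod_nonneg fun i hi ↦ hs i (Finset.mem_range.mp hi)
  refine ContinuousAlternatingMap.opNorm_le_bound _ (by positivity) fun X ↦ ?_
  by_cases hX : LinearIndependent ℝ X
  · let U := Submodule.span ℝ (range X)
    have : FiniteDimensional ℝ U := FiniteDimensional.span_of_finite ℝ (finite_range X)
    have hU : finrank ℝ U = k := by simpa using finrank_span_eq_card hX
    obtain ⟨b, hb, hbU, hbs⟩ := exists_orthonormal_norm_map_le (S := S.toLinearMap) hS U hU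
    have hbo : Orthonormal ℝ fun i ↦ (⟨b i, hbU i⟩ : U) := by
      rw [orthonormal_iff_ite] at hb ⊢
      exact hb
    have hspan : ⊤ ≤ Submodule.span ℝ (range fun i ↦ (⟨b i, hbU i⟩ : U)) :=
      (hbo.linearIndependent.span_eq_top_of_card_eq_finrank' (by simp [hU])).ge
    have key := abs_alternatingMap_le (OrthonormalBasis.mk hbo hspan)
      ((η.compContinuousLinearMap S).toAlternatingMap.compLinearMap U.subtype)
      fun i ↦ ⟨X i, Submodule.subset_span (mem_range_self i)⟩
    have hval : |η fun i ↦ S (b i)| ≤ (∏ i ∈ Finset.range k, s i) * ‖η‖ := by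
      refine (η.le_opNorm _).trans ?_
      rw [mul_comm]
      gcongr
      refine (Finset.prod_le_prod (fun _ _ ↦ norm_nonneg _) fun i _ ↦ hbs i).trans_eq ?_
      rw [← Fin.prod_univ_eq_prod_range]
      exact Equiv.prod_comp Fin.revPerm fun i : Fin k ↦ s i
    refine le_trans ?_ (mul_le_mul_of_nonneg_right hval (Finset.prod_nonneg fun _ _ ↦ norm_nonneg _))
    simpa [Function.comp_def] using key
  · have h0 := AlternatingMap.map_linearDependent (η.compContinuousLinearMap S).toAlternatingMap X hX
    have h0' : (η.compContinuousLinearMap S) X = 0 := h0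
    rw [h0', norm_zero]
    positivity

end Bound

section SingularValues

variable {n : ℕ} {V W : Type*} [NormedAddCommGroup V] [InnerProductSpace ℝ V]
  [FiniteDimensional ℝ V] [NormedAddCommGroup W] [InnerProductSpace ℝ W] [FiniteDimensional ℝ W]

/-- The right singular vectors of a linear map: an orthonormal basis whose images are orthogonal,
the norm of the `i`-th image being the `i`-th singular value. -/
theorem exists_orthonormalBasis_singularValues (T : V →ₗ[ℝ] W) (hn : finrank ℝ V = n) :
    ∃ e : OrthonormalBasis (Fin n) ℝ V,
      ∀ i v, ⟪T (e i), T v⟫ = T.singularValues i ^ 2 * ⟪e i, v⟫ := by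
  refine ⟨T.isSymmetric_adjoint_comp_self.eigenvectorBasis hn, fun i v ↦ ?_⟩
  rw [← LinearMap.adjoint_inner_left, ← LinearMap.comp_apply,
    LinearMap.IsSymmetric.apply_eigenvectorBasis, T.sq_singularValues_fin hn, inner_smul_left]
  simp

theorem norm_sq_map_eq_sum_singularValues {T : V →ₗ[ℝ] W} {e : OrthonormalBasis (Fin n) ℝ V}
    (he : ∀ i v, ⟪T (e i), T v⟫ = T.singularValues i ^ 2 * ⟪e i, v⟫) (v : V) :
    ‖T v‖ ^ 2 = ∑ i : Fin n, T.singularValues i ^ 2 * ⟪e i, v⟫ ^ 2 := by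
  have h : ⟪T (∑ i, ⟪e i, v⟫ • e i), T v⟫ = ‖T v‖ ^ 2 := by
    rw [e.sum_repr' v, real_inner_self_eq_norm_sq]
  rw [← h]
  simp only [map_sum, map_smul, sum_inner, inner_smul_left, he]
  exact Finset.sum_congr rfl fun i _ ↦ by simp; ring

theorem norm_compContinuousLinearMap_le_prod_singularValues (T : V →L[ℝ] W)
    (hn : finrank ℝ V = n) {k : ℕ} (η : W [⋀^Fin k]→L[ℝ] ℝ) :
    ‖η.compContinuousLinearMap T‖ ≤
      (∏ i ∈ Finset.range k, T.toLinearMap.singularValues i) * ‖η‖ := by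
  obtain ⟨e, he⟩ := exists_orthonormalBasis_singularValues T.toLinearMap hn
  refine norm_compContinuousLinearMap_le_prod (f := fun i ↦ if h : i < n then e ⟨i, h⟩ else 0)
    (fun j _ ↦ T.toLinearMap.singularValues_nonneg j) (fun j _ v hv ↦ ?_) η
  have hα := T.toLinearMap.singularValues_nonneg j
  refine le_of_sq_le_sq ?_ (by positivity)
  have h := norm_sq_map_eq_sum_singularValues he v
  rw [ContinuousLinearMap.coe_coe] at h
  rw [h, mul_pow, ← e.sum_sq_norm_inner_right v, Finset.mul_sum]
  refine Finset.sum_le_sum fun i _ ↦ ?_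
  rw [Real.norm_eq_abs, sq_abs]
  rcases lt_or_ge (i : ℕ) j with hij | hij
  · have := hv i hij
    simp only [i.2, dif_pos] at this
    simp [this]
  · gcongr
    · exact T.toLinearMap.singularValues_nonneg i
    · exact T.toLinearMap.singularValues_antitone hij

/-- The singular values of the inverse of `T` are the inverses of those of `T`, in the reverse
order. -/
theorem norm_compContinuousLinearMap_symm_le_prod_singularValues (T : V ≃L[ℝ] W)
    (hn : finrank ℝ V = n) {k : ℕ} (hk : k ≤ n) (η : V [⋀^Fin k]→L[ℝ] ℝ) :
    ‖η.compContinuousLinearMap (T.symm : W →L[ℝ] V)‖ ≤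
      (∏ i ∈ Finset.Ico (n - k) n, (T : V →L[ℝ] W).toLinearMap.singularValues i)⁻¹ * ‖η‖ := by
  set A := (T : V →L[ℝ] W).toLinearMap with hA
  have hpos : ∀ i < n, 0 < A.singularValues i := fun i hi ↦
    A.injective_iff_forall_lt_finrank_singularValues_pos.mp T.injective i (hn ▸ hi)
  obtain ⟨e, he⟩ := exists_orthonormalBasis_singularValues A hn
  have hprod : (∏ i ∈ Finset.Ico (n - k) n, A.singularValues i)⁻¹ =
      ∏ i ∈ Finset.range k, (A.singularValues (n - 1 - i))⁻¹ := by
    rw [Finset.prod_inv_distrib, Finset.prod_Ico_eq_prod_range, Nat.sub_sub_self hk,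
      ← Finset.prod_range_reflect]
    congr 1
    refine Finset.prod_congr rfl fun i hi ↦ ?_
    have := Finset.mem_range.mp hi
    congr 1
    omega
  rw [hprod]
  -- The left singular vectors `A (e i)`, in the reverse order, serve as the right singular vectors
  -- of the inverse; they need not be normalized.
  refine norm_compContinuousLinearMap_le_prod
    (f := fun i ↦ if h : n - 1 - i < n then A (e ⟨n - 1 - i, h⟩) else 0)
    (fun j _ ↦ inv_nonneg.mpr (A.singularValues_nonneg _)) (fun j hj w hw ↦ ?_) η
  obtain ⟨v, rfl⟩ := T.surjective w
  have hj' := hpos (n - 1 - j) (by omega)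
  rw [ContinuousLinearEquiv.coe_coe, T.symm_apply_apply, inv_mul_eq_div, le_div_iff₀ hj']
  refine le_of_sq_le_sq ?_ (by positivity)
  have h : ‖T v‖ ^ 2 = _ := norm_sq_map_eq_sum_singularValues he v
  rw [h, mul_pow, ← e.sum_sq_norm_inner_right v, Finset.sum_mul]
  refine Finset.sum_le_sum fun i _ ↦ ?_
  rw [Real.norm_eq_abs, sq_abs, mul_comm]
  rcases lt_or_ge (n - 1 - j) (i : ℕ) with hij | hij
  · have := hw (n - 1 - i) (by omega)
    have hi : n - 1 - (n - 1 - (i : ℕ)) = i := by omega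
    simp only [hi, i.2, dif_pos] at this
    have h2 : A.singularValues i ^ 2 * ⟪e i, v⟫ = 0 := (he i v).symm.trans this
    have h3 : ⟪e i, v⟫ = 0 := by
      simpa [(hpos i i.2).ne'] using h2
    simp [h3]
  · gcongr
    exact A.singularValues_antitone hij

theorem singularValues_le_opNorm (T : V →L[ℝ] W) (i : ℕ) :
    T.toLinearMap.singularValues i ≤ ‖T‖ := by
  rcases lt_or_ge i (finrank ℝ V) with hi | hi
  · obtain ⟨e, he⟩ := exists_orthonormalBasis_singularValues T.toLinearMap rfl
    have h := he ⟨i, hi⟩ (e ⟨i, hi⟩)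
    rw [real_inner_self_eq_norm_sq, real_inner_self_eq_norm_sq, e.norm_eq_one] at h
    have h2 := T.le_opNorm (e ⟨i, hi⟩)
    rw [e.norm_eq_one, mul_one] at h2
    refine le_trans (le_of_eq ?_) h2
    rw [← sq_eq_sq₀ (T.toLinearMap.singularValues_nonneg _) (norm_nonneg _)]
    simpa using h.symm
  · rw [LinearMap.singularValues_of_finrank_le _ hi]
    positivity

theorem inv_singularValues_le_opNorm_symm (T : V ≃L[ℝ] W) (i : ℕ) :
    ((T : V →L[ℝ] W).toLinearMap.singularValues i)⁻¹ ≤ ‖(T.symm : W →L[ℝ] V)‖ := by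
  set A := (T : V →L[ℝ] W).toLinearMap with hA
  rcases lt_or_ge i (finrank ℝ V) with hi | hi
  · have hpos := A.injective_iff_forall_lt_finrank_singularValues_pos.mp T.injective i hi
    obtain ⟨e, he⟩ := exists_orthonormalBasis_singularValues A rfl
    have h := he ⟨i, hi⟩ (e ⟨i, hi⟩)
    rw [real_inner_self_eq_norm_sq, real_inner_self_eq_norm_sq, e.norm_eq_one] at h
    have h2 := (T.symm : W →L[ℝ] V).le_opNorm (T (e ⟨i, hi⟩))
    have h3 : ‖T (e ⟨i, hi⟩)‖ = A.singularValues i := by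
      rw [← sq_eq_sq₀ (norm_nonneg _) (A.singularValues_nonneg _)]
      rw [one_pow, mul_one] at h
      exact h
    rw [ContinuousLinearEquiv.coe_coe, T.symm_apply_apply, e.norm_eq_one, h3] at h2
    rwa [inv_le_iff_one_le_mul₀ hpos]
  · rw [LinearMap.singularValues_of_finrank_le _ hi, inv_zero]
    positivity

end SingularValues

end LinearAlgebra

/-! ### Volume densities of parametrizations and the Riemannian Jacobian -/

theorem finiteDimensional_tangentSpace {n : ℕ} {M : Type*} [TopologicalSpace M]
    [ChartedSpace (EuclideanSpace ℝ (Fin n)) M] (x : M) :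
    FiniteDimensional ℝ (TangentSpace (𝓡 n) x) :=
  inferInstanceAs (FiniteDimensional ℝ (EuclideanSpace ℝ (Fin n)))

attribute [local instance] finiteDimensional_tangentSpace

section Riemannian

open Module

variable {n : ℕ} {M : Type*} [TopologicalSpace M] [ChartedSpace (EuclideanSpace ℝ (Fin n)) M]

theorem finrank_tangentSpace (x : M) : finrank ℝ (TangentSpace (𝓡 n) x) = n :=
  finrank_euclideanSpace_fin (𝕜 := ℝ) (n := n)

theorem mdifferentiableAt_chartAt_symm [IsManifold (𝓡 n) ∞ M] {x₀ : M} {u : EuclideanSpace ℝ (Fin n)}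
    (hu : u ∈ (chartAt (EuclideanSpace ℝ (Fin n)) x₀).target) :
    MDifferentiableAt (𝓡 n) (𝓡 n) (chartAt (EuclideanSpace ℝ (Fin n)) x₀).symm u :=
  (mdifferentiable_chart (I := 𝓡 n) x₀).mdifferentiableAt_symm hu

variable [RiemannianBundle (fun x : M ↦ TangentSpace (𝓡 n) x)]

/-- The volume density of a parametrization `f : ℝⁿ → M`: the factor by which the derivative of
`f` at `u` scales volumes, where `ℝⁿ` carries the Euclidean inner product and the tangent space
`T_{f u} M` the Riemannian one. -/
def paramDensity (f : EuclideanSpace ℝ (Fin n) → M) (u : EuclideanSpace ℝ (Fin n)) : ℝ :=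
  LinearMap.normDet (U := EuclideanSpace ℝ (Fin n)) (mfderiv (𝓡 n) (𝓡 n) f u).toLinearMap

theorem paramDensity_eq_sqrt_det_gram (f : EuclideanSpace ℝ (Fin n) → M)
    (u : EuclideanSpace ℝ (Fin n)) :
    paramDensity f u = √(Matrix.gram ℝ fun i : Fin n ↦ (mfderiv (𝓡 n) (𝓡 n) f u
      (EuclideanSpace.basisFun (Fin n) ℝ i) : TangentSpace (𝓡 n) (f u))).det := by
  have h := LinearMap.normDet_sq_eq_det_gram (U := EuclideanSpace ℝ (Fin n))
    (mfderiv (𝓡 n) (𝓡 n) f u).toLinearMap (EuclideanSpace.basisFun (Fin n) ℝ)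
  rw [RCLike.ofReal_real_eq_id, id] at h
  exact ((congrArg Real.sqrt h).symm.trans (Real.sqrt_sq (LinearMap.normDet_nonneg _))).symm

theorem riemannianDensity_eq_paramDensity (x₀ : M) (u : EuclideanSpace ℝ (Fin n)) :
    riemannianDensity x₀ u
      = paramDensity (chartAt (EuclideanSpace ℝ (Fin n)) x₀).symm u :=
  (paramDensity_eq_sqrt_det_gram _ u).symm

theorem isContinuousRiemannianBundle_tangentSpace [IsManifold (𝓡 n) ∞ M]
    [h : IsContMDiffRiemannianBundle (𝓡 n) ∞ (EuclideanSpace ℝ (Fin n))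
      (fun x : M ↦ TangentSpace (𝓡 n) x)] :
    IsContinuousRiemannianBundle (EuclideanSpace ℝ (Fin n))
      (fun x : M ↦ TangentSpace (𝓡 n) x) :=
  let ⟨g, hg, hg'⟩ := h.exists_contMDiff
  ⟨g, hg.continuous, hg'⟩

theorem continuousOn_paramDensity [IsManifold (𝓡 n) ∞ M]
    [IsContMDiffRiemannianBundle (𝓡 n) ∞ (EuclideanSpace ℝ (Fin n))
      (fun x : M ↦ TangentSpace (𝓡 n) x)]
    {f : EuclideanSpace ℝ (Fin n) → M} {s : Set (EuclideanSpace ℝ (Fin n))} (hs : IsOpen s)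
    (hf : ContMDiffOn (𝓡 n) (𝓡 n) ∞ f s) : ContinuousOn (paramDensity f) s := by
  have : ContinuousOn (fun u ↦ √(Matrix.gram ℝ fun i : Fin n ↦ (mfderiv (𝓡 n) (𝓡 n) f u
      (EuclideanSpace.basisFun (Fin n) ℝ i) : TangentSpace (𝓡 n) (f u))).det) s := by
    refine Real.continuous_sqrt.comp_continuousOn ?_
    refine Continuous.comp_continuousOn (g := Matrix.det) (continuous_id.matrix_det) ?_
    refine continuousOn_pi.mpr fun i ↦ continuousOn_pi.mpr fun j ↦ ?_
    have hv : ∀ v : EuclideanSpace ℝ (Fin n), ContinuousOn (fun u ↦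
      (TotalSpace.mk' (EuclideanSpace ℝ (Fin n)) (f u) (mfderiv (𝓡 n) (𝓡 n) f u v) :
        TangentBundle (𝓡 n) M)) s := by
      intro v
      have h1 := hf.continuousOn_tangentMapWithin (by simp) hs.uniqueMDiffOn
      have h2 : Continuous fun u : EuclideanSpace ℝ (Fin n) ↦
          (TotalSpace.mk' (EuclideanSpace ℝ (Fin n)) u v :
            TangentBundle (𝓡 n) (EuclideanSpace ℝ (Fin n))) :=
        (tangentBundleModelSpaceHomeomorph (𝓡 n)).symm.continuous.comp
          (Continuous.prodMk_left v)
      refine (h1.comp h2.continuousOn fun u hu ↦ hu).congr fun u hu ↦ ?_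
      simp only [Function.comp_apply, tangentMapWithin, mfderivWithin_of_isOpen hs hu]
    have := isContinuousRiemannianBundle_tangentSpace (n := n) (M := M)
    simp only [Matrix.gram_apply]
    exact (hv _).inner_bundle (hv _)
  exact this.congr fun u _ ↦ paramDensity_eq_sqrt_det_gram f u

theorem paramDensity_nonneg (f : EuclideanSpace ℝ (Fin n) → M) (u : EuclideanSpace ℝ (Fin n)) :
    0 ≤ paramDensity f u :=
  LinearMap.normDet_nonneg _

theorem paramDensity_congr {f g : EuclideanSpace ℝ (Fin n) → M} {u : EuclideanSpace ℝ (Fin n)}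
    (h : f =ᶠ[𝓝 u] g) : paramDensity f u = paramDensity g u := by
  -- The two tangent maps have codomains `T_{f u} M` and `T_{g u} M`, whose norms agree only after
  -- the identification of `f u` with `g u`.
  have key : ∀ (p q : M) (_ : p = q)
      (A : EuclideanSpace ℝ (Fin n) →L[ℝ] TangentSpace (𝓡 n) p)
      (B : EuclideanSpace ℝ (Fin n) →L[ℝ] TangentSpace (𝓡 n) q)
      (_ : ∀ v : EuclideanSpace ℝ (Fin n),
        (A v : EuclideanSpace ℝ (Fin n)) = (B v : EuclideanSpace ℝ (Fin n))),
      A.toLinearMap.normDet = B.toLinearMap.normDet := by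
    rintro p _ rfl A B hAB
    congr 1
    ext1 v
    exact hAB v
  have hd : (mfderiv (𝓡 n) (𝓡 n) f u : EuclideanSpace ℝ (Fin n) →L[ℝ] EuclideanSpace ℝ (Fin n)) =
      mfderiv (𝓡 n) (𝓡 n) g u := h.mfderiv_eq
  exact key (f u) (g u) h.eq_of_nhds _ _ fun v ↦ congrArg (fun L ↦ L v) hd

theorem paramDensity_comp {f : EuclideanSpace ℝ (Fin n) → M}
    {F : EuclideanSpace ℝ (Fin n) → EuclideanSpace ℝ (Fin n)} {u : EuclideanSpace ℝ (Fin n)}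
    (hf : MDifferentiableAt (𝓡 n) (𝓡 n) f (F u)) (hF : DifferentiableAt ℝ F u) :
    paramDensity (f ∘ F) u = paramDensity f (F u) * |(fderiv ℝ F u).det| := by
  rw [paramDensity, mfderiv_comp u hf hF.mdifferentiableAt, mfderiv_eq_fderiv]
  rw [paramDensity, ContinuousLinearMap.det, ← LinearMap.normDet_eq_abs_det]
  exact LinearMap.normDet_comp_of_finrank_eq (V := EuclideanSpace ℝ (Fin n))
    (fderiv ℝ F u).toLinearMap (mfderiv (𝓡 n) (𝓡 n) f (F u)).toLinearMap rfl

theorem paramDensity_chartAt_symm_pos [IsManifold (𝓡 n) ∞ M] {x₀ : M}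
    {u : EuclideanSpace ℝ (Fin n)}
    (hu : u ∈ (chartAt (EuclideanSpace ℝ (Fin n)) x₀).target) :
    0 < paramDensity (chartAt (EuclideanSpace ℝ (Fin n)) x₀).symm u := by
  refine (paramDensity_nonneg _ _).lt_of_ne' ?_
  have h := ((mdifferentiable_chart (I := 𝓡 n) x₀).symm.mfderiv_injective hu)
  exact ((LinearMap.normDet_ne_zero_tfae (U := EuclideanSpace ℝ (Fin n))
    (mfderiv (𝓡 n) (𝓡 n) (chartAt (EuclideanSpace ℝ (Fin n)) x₀).symm u).toLinearMap).out 0 4).mpr h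

section Jacobian

variable {N : Type*} [TopologicalSpace N] [ChartedSpace (EuclideanSpace ℝ (Fin n)) N]
  [RiemannianBundle (fun y : N ↦ TangentSpace (𝓡 n) y)]

/-- The Riemannian Jacobian of `φ` at `x`: the factor by which the tangent map scales volumes. -/
def riemannianJacobian (φ : M ≃ₘ⟮𝓡 n, 𝓡 n⟯ N) (x : M) : ℝ :=
  (mfderiv (𝓡 n) (𝓡 n) φ x).toLinearMap.normDet

theorem riemannianJacobian_eq_prod_singularValue (φ : M ≃ₘ⟮𝓡 n, 𝓡 n⟯ N) (x : M) :
    riemannianJacobian φ x = ∏ i ∈ Finset.range n, singularValue φ x i := by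
  rw [riemannianJacobian, LinearMap.normDet_eq_prod_singularValues, finrank_tangentSpace]
  rfl

theorem paramDensity_diffeomorph_comp {f : EuclideanSpace ℝ (Fin n) → M}
    {u : EuclideanSpace ℝ (Fin n)} (φ : M ≃ₘ⟮𝓡 n, 𝓡 n⟯ N)
    (hf : MDifferentiableAt (𝓡 n) (𝓡 n) f u) :
    paramDensity (φ ∘ f) u = riemannianJacobian φ (f u) * paramDensity f u := by
  rw [paramDensity, mfderiv_comp u (φ.mdifferentiable (by simp) _) hf]
  exact LinearMap.normDet_comp_of_finrank_eq (U := EuclideanSpace ℝ (Fin n))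
    (mfderiv (𝓡 n) (𝓡 n) f u).toLinearMap (mfderiv (𝓡 n) (𝓡 n) φ (f u)).toLinearMap
    (finrank_euclideanSpace_fin.trans (finrank_tangentSpace (n := n) (f u)).symm)

theorem riemannianJacobian_pos (φ : M ≃ₘ⟮𝓡 n, 𝓡 n⟯ N) (x : M) : 0 < riemannianJacobian φ x := by
  refine (LinearMap.normDet_nonneg _).lt_of_ne' ?_
  exact ((LinearMap.normDet_ne_zero_tfae (mfderiv (𝓡 n) (𝓡 n) φ x).toLinearMap).out 0 4).mpr
    (φ.mfderivToContinuousLinearEquiv (by simp) x).injective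

theorem riemannianJacobian_refl (x : M) :
    riemannianJacobian (Diffeomorph.refl (𝓡 n) M ∞) x = 1 := by
  have h : mfderiv (𝓡 n) (𝓡 n) (Diffeomorph.refl (𝓡 n) M ∞) x =
    ContinuousLinearMap.id ℝ (TangentSpace (𝓡 n) x) := mfderiv_id
  rw [riemannianJacobian, h]
  exact LinearMap.normDet_id

variable [IsManifold (𝓡 n) ∞ M] [IsContMDiffRiemannianBundle (𝓡 n) ∞ (EuclideanSpace ℝ (Fin n))
  (fun x : M ↦ TangentSpace (𝓡 n) x)]
  [IsManifold (𝓡 n) ∞ N] [IsContMDiffRiemannianBundle (𝓡 n) ∞ (EuclideanSpace ℝ (Fin n))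
  (fun x : N ↦ TangentSpace (𝓡 n) x)]

/-- In a chart `χ`, the Jacobian is the quotient of the densities of the parametrizations
`φ ∘ χ.symm` and `χ.symm`, which are continuous. -/
theorem continuous_riemannianJacobian (φ : M ≃ₘ⟮𝓡 n, 𝓡 n⟯ N) :
    Continuous (riemannianJacobian φ) := by
  refine continuous_iff_continuousAt.mpr fun x₀ ↦ ?_
  set χ := chartAt (EuclideanSpace ℝ (Fin n)) x₀ with hχ
  have hsm : ContMDiffOn (𝓡 n) (𝓡 n) ∞ χ.symm χ.target := contMDiffOn_chart_symm
  have h1 := continuousOn_paramDensity χ.open_target hsm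
  have h2 := continuousOn_paramDensity χ.open_target (φ.contMDiff.comp_contMDiffOn hsm)
  have h3 : ContinuousOn (fun u ↦ paramDensity (φ ∘ χ.symm) u / paramDensity χ.symm u) χ.target :=
    h2.div h1 fun u hu ↦ (paramDensity_chartAt_symm_pos hu).ne'
  have h4 := h3.comp χ.continuousOn χ.mapsTo
  have hx : χ.source ∈ 𝓝 x₀ := χ.open_source.mem_nhds (mem_chart_source _ x₀)
  refine (h4.congr fun x hx ↦ ?_).continuousAt hx
  have hu := χ.map_source hx
  rw [Function.comp_apply, paramDensity_diffeomorph_comp φ (mdifferentiableAt_chartAt_symm hu),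
    χ.left_inv hx, mul_div_cancel_right₀ _ (paramDensity_chartAt_symm_pos hu).ne']

end Jacobian

end Riemannian

/-! ### Change of variables for the Riemannian volume -/

theorem OpenPartialHomeomorph.measurableSet_target_inter_preimage {X Y : Type*}
    [TopologicalSpace X] [MeasurableSpace X] [BorelSpace X]
    [TopologicalSpace Y] [MeasurableSpace Y] [BorelSpace Y] (e : OpenPartialHomeomorph X Y)
    {A : Set X} (hA : MeasurableSet A) : MeasurableSet (e.target ∩ e.symm ⁻¹' A) := by
  have h1 : Measurable fun y : e.target ↦ e.symm y :=
    (continuousOn_iff_continuous_domRestrict.mp e.continuousOn_symm).measurable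
  have h2 := e.open_target.measurableSet.subtype_image (h1 hA)
  convert! h2 using 1
  ext y
  simp [and_comm]

section Volume

variable {n : ℕ} {M : Type*} [TopologicalSpace M]
  [ChartedSpace (EuclideanSpace ℝ (Fin n)) M] [IsManifold (𝓡 n) ∞ M]
  [RiemannianBundle (fun x : M ↦ TangentSpace (𝓡 n) x)]
  [IsContMDiffRiemannianBundle (𝓡 n) ∞ (EuclideanSpace ℝ (Fin n))
    (fun x : M ↦ TangentSpace (𝓡 n) x)]
  [MeasurableSpace M] [BorelSpace M]

theorem setLIntegral_chartVolume (x₀ : M) {A : Set M} (hA : MeasurableSet A) {g : M → ℝ≥0∞}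
    (hg : Measurable g) :
    ∫⁻ x in A, g x ∂(chartVolume (n := n) x₀) =
      ∫⁻ u in (chartAt (EuclideanSpace ℝ (Fin n)) x₀).target ∩
        (chartAt (EuclideanSpace ℝ (Fin n)) x₀).symm ⁻¹' A,
        ENNReal.ofReal (paramDensity (chartAt (EuclideanSpace ℝ (Fin n)) x₀).symm u) *
          g ((chartAt (EuclideanSpace ℝ (Fin n)) x₀).symm u) := by
  set χ := chartAt (EuclideanSpace ℝ (Fin n)) x₀ with hχ
  have hρ : AEMeasurable (fun u ↦ ENNReal.ofReal (riemannianDensity x₀ u))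
      (volume.restrict χ.target) := by
    have h := (continuousOn_paramDensity (n := n) χ.open_target contMDiffOn_chart_symm).aemeasurable
      (μ := volume) χ.open_target.measurableSet
    simp only [riemannianDensity_eq_paramDensity]
    exact h.ennreal_ofReal
  have hsymm : AEMeasurable χ.symm (volume.restrict χ.target) :=
    χ.continuousOn_symm.aemeasurable χ.open_target.measurableSet
  have hsymm' := hsymm.mono_ac (withDensity_absolutelyContinuous (volume.restrict χ.target)
    fun u ↦ ENNReal.ofReal (riemannianDensity x₀ u))
  have hgA : Measurable (A.indicator g) := hg.indicator hA
  have hset := χ.measurableSet_target_inter_preimage hA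
  rw [← lintegral_indicator hA, chartVolume, lintegral_map' hgA.aemeasurable hsymm',
    lintegral_withDensity_eq_lintegral_mul₀ (g := fun u ↦ A.indicator g (χ.symm u)) hρ
      (hgA.comp_aemeasurable hsymm),
    ← lintegral_indicator hset, ← lintegral_indicator χ.open_target.measurableSet]
  refine lintegral_congr fun u ↦ ?_
  by_cases hu : u ∈ χ.target <;> by_cases huA : χ.symm u ∈ A <;>
    simp [indicator, hu, huA, riemannianDensity_eq_paramDensity, ← hχ]

theorem chartVolume_compl_source (x₀ : M) :
    chartVolume (n := n) x₀ (chartAt (EuclideanSpace ℝ (Fin n)) x₀).sourceᶜ = 0 := by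
  set χ := chartAt (EuclideanSpace ℝ (Fin n)) x₀ with hχ
  have h := setLIntegral_chartVolume (n := n) x₀ χ.open_source.measurableSet.compl
    (measurable_const (a := (1 : ℝ≥0∞)))
  have h0 : χ.target ∩ χ.symm ⁻¹' χ.sourceᶜ = ∅ := by
    ext u
    simpa using fun hu ↦ χ.map_target hu
  rw [← hχ, h0] at h
  simpa using h

variable {N : Type*} [TopologicalSpace N]
  [ChartedSpace (EuclideanSpace ℝ (Fin n)) N] [IsManifold (𝓡 n) ∞ N]
  [RiemannianBundle (fun x : N ↦ TangentSpace (𝓡 n) x)]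
  [IsContMDiffRiemannianBundle (𝓡 n) ∞ (EuclideanSpace ℝ (Fin n))
    (fun x : N ↦ TangentSpace (𝓡 n) x)]
  [MeasurableSpace N] [BorelSpace N]

/-- The change of variables formula for a diffeomorphism, inside a chart of the source and a chart
of the target. -/
theorem chartVolume_image (φ : M ≃ₘ⟮𝓡 n, 𝓡 n⟯ N) (x₀ : M) (y₀ : N) {A : Set M}
    (hA : MeasurableSet A) (hAx : A ⊆ (chartAt (EuclideanSpace ℝ (Fin n)) x₀).source)
    (hAy : A ⊆ φ ⁻¹' (chartAt (EuclideanSpace ℝ (Fin n)) y₀).source) :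
    chartVolume (n := n) y₀ (φ '' A) =
      ∫⁻ x in A, ENNReal.ofReal (riemannianJacobian φ x) ∂(chartVolume (n := n) x₀) := by
  set χ := chartAt (EuclideanSpace ℝ (Fin n)) x₀ with hχ
  set ψ := chartAt (EuclideanSpace ℝ (Fin n)) y₀ with hψ
  set F : EuclideanSpace ℝ (Fin n) → EuclideanSpace ℝ (Fin n) := ψ ∘ φ ∘ χ.symm with hF
  set s := χ.target ∩ χ.symm ⁻¹' A with hs
  have hφA : MeasurableSet (φ '' A) := by
    have : φ '' A = φ.symm ⁻¹' A := φ.toEquiv.image_eq_preimage_symm A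
    rw [this]
    exact φ.symm.continuous.measurable hA
  have hsm : MeasurableSet s := χ.measurableSet_target_inter_preimage hA
  have hV : ∀ u ∈ s, ∀ᶠ v in 𝓝 u, v ∈ χ.target ∧ φ (χ.symm v) ∈ ψ.source := by
    intro u hu
    refine Filter.Eventually.and (χ.open_target.mem_nhds hu.1) ?_
    exact (φ.continuous.continuousAt.comp (χ.continuousAt_symm hu.1)).eventually
      (ψ.open_source.mem_nhds (hAy hu.2))
  have hFd : ∀ u ∈ s, DifferentiableAt ℝ F u := by
    intro u hu
    have h1 := mdifferentiableAt_chartAt_symm (n := n) hu.1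
    have h2 : MDifferentiableAt (𝓡 n) (𝓡 n) φ (χ.symm u) := φ.mdifferentiable (by simp) _
    have h3 : MDifferentiableAt (𝓡 n) (𝓡 n) ψ (φ (χ.symm u)) :=
      (mdifferentiable_chart (I := 𝓡 n) y₀).mdifferentiableAt (hAy hu.2)
    exact (h3.comp u (h2.comp u h1)).differentiableAt
  have hinj : InjOn F s := by
    intro u hu v hv huv
    exact χ.symm.injOn hu.1 hv.1 (φ.injective (ψ.injOn (hAy hu.2) (hAy hv.2) huv))
  have himage : F '' s = ψ.target ∩ ψ.symm ⁻¹' (φ '' A) := by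
    ext w
    constructor
    · rintro ⟨u, hu, rfl⟩
      refine ⟨ψ.map_source (hAy hu.2), χ.symm u, hu.2, ?_⟩
      exact (ψ.left_inv (hAy hu.2)).symm
    · rintro ⟨hw, x, hx, hxw⟩
      refine ⟨χ x, ⟨χ.map_source (hAx hx), ?_⟩, ?_⟩
      · rwa [mem_preimage, χ.left_inv (hAx hx)]
      · simp only [hF, Function.comp_apply]
        rw [χ.left_inv (hAx hx), hxw, ψ.right_inv hw]
  have hleft := setLIntegral_chartVolume (n := n) y₀ hφA (measurable_const (a := (1 : ℝ≥0∞)))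
  rw [← hψ, ← himage, lintegral_image_eq_lintegral_abs_det_fderiv_mul volume hsm
    (fun u hu ↦ (hFd u hu).hasFDerivAt.hasFDerivWithinAt) hinj] at hleft
  rw [setLIntegral_chartVolume x₀ hA
    (continuous_riemannianJacobian φ).measurable.ennreal_ofReal, ← hχ, ← hs]
  rw [setLIntegral_one] at hleft
  rw [hleft]
  refine setLIntegral_congr_fun hsm fun u hu ↦ ?_
  have h1 := mdifferentiableAt_chartAt_symm (n := n) hu.1
  have hFu : F u ∈ ψ.target := ψ.map_source (hAy hu.2)
  -- The parametrization `φ ∘ χ.symm` of `N` and the reparametrization `ψ.symm ∘ F` of the inverse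
  -- chart coincide near `u`; comparing their densities gives the transformation law.
  have hev : ψ.symm ∘ F =ᶠ[𝓝 u] φ ∘ χ.symm := by
    filter_upwards [hV u hu] with v hv
    exact ψ.left_inv hv.2
  have h2 := paramDensity_congr (n := n) hev
  rw [paramDensity_comp (mdifferentiableAt_chartAt_symm hFu) (hFd u hu),
    paramDensity_diffeomorph_comp φ h1] at h2
  simp only [mul_one]
  rw [← ENNReal.ofReal_mul (abs_nonneg _), ← ENNReal.ofReal_mul (paramDensity_nonneg _ _),
    mul_comm, h2, mul_comm]

/-- The chart measures agree on overlaps: this is the change of variables formula for the identity. -/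
theorem chartVolume_apply_eq_of_subset (x₀ x₁ : M) {A : Set M} (hA : MeasurableSet A)
    (h₀ : A ⊆ (chartAt (EuclideanSpace ℝ (Fin n)) x₀).source)
    (h₁ : A ⊆ (chartAt (EuclideanSpace ℝ (Fin n)) x₁).source) :
    chartVolume (n := n) x₁ A = chartVolume (n := n) x₀ A := by
  have h := chartVolume_image (Diffeomorph.refl (𝓡 n) M ∞) x₀ x₁ hA h₀ h₁
  simpa [riemannianJacobian_refl] using h

/-- On the domain of a chart the Riemannian volume is `√(det g_ij) dy`. -/
theorem riemannianVolume_apply_of_subset (x₀ : M) {A : Set M} (hA : MeasurableSet A)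
    (h₀ : A ⊆ (chartAt (EuclideanSpace ℝ (Fin n)) x₀).source) :
    riemannianVolume n M A = chartVolume (n := n) x₀ A := by
  set χ := chartAt (EuclideanSpace ℝ (Fin n)) x₀ with hχ
  refine le_antisymm ?_ (le_iSup (fun x₀ : M ↦ chartVolume (n := n) x₀) x₀ A)
  -- This measure dominates every `chartVolume x₁`, hence their supremum.
  have hle : riemannianVolume n M ≤
      chartVolume (n := n) x₀ + (riemannianVolume n M).restrict χ.sourceᶜ := by
    refine iSup_le fun x₁ ↦ Measure.le_iff.mpr fun B hB ↦ ?_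
    set χ₁ := chartAt (EuclideanSpace ℝ (Fin n)) x₁ with hχ₁
    rw [← measure_inter_add_sdiff B χ.open_source.measurableSet, Measure.add_apply,
      Measure.restrict_apply hB]
    refine add_le_add ?_ (le_iSup (fun x₀ : M ↦ chartVolume (n := n) x₀) x₁ _)
    have hnull : chartVolume (n := n) x₁ ((B ∩ χ.source) \ χ₁.source) = 0 :=
      measure_mono_null (fun x hx ↦ hx.2) (chartVolume_compl_source x₁)
    rw [← measure_inter_add_sdiff (B ∩ χ.source) χ₁.open_source.measurableSet, hnull, add_zero,
      chartVolume_apply_eq_of_subset x₀ x₁ ((hB.inter χ.open_source.measurableSet).inter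
        χ₁.open_source.measurableSet) (fun x hx ↦ hx.1.2) fun x hx ↦ hx.2]
    exact measure_mono fun x hx ↦ hx.1.1
  refine (hle A).trans_eq ?_
  rw [Measure.add_apply, Measure.restrict_apply hA]
  have : A ∩ χ.sourceᶜ = ∅ := by
    rw [← sdiff_eq]; exact sdiff_eq_empty.mpr h₀
  simp [this]

theorem riemannianVolume_restrict_of_subset (x₀ : M) {A : Set M} (hA : MeasurableSet A)
    (h₀ : A ⊆ (chartAt (EuclideanSpace ℝ (Fin n)) x₀).source) :
    (riemannianVolume n M).restrict A = (chartVolume (n := n) x₀).restrict A := by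
  ext B hB
  rw [Measure.restrict_apply hB, Measure.restrict_apply hB,
    riemannianVolume_apply_of_subset x₀ (hB.inter hA) (inter_subset_right.trans h₀)]

/-- The change of variables formula for a diffeomorphism: `φ^* μ_N = J μ_M`, where `J` is the
Riemannian Jacobian of `φ`. -/
theorem riemannianVolume_eq_map_withDensity [SecondCountableTopology M]
    (φ : M ≃ₘ⟮𝓡 n, 𝓡 n⟯ N) :
    riemannianVolume n N = ((riemannianVolume n M).withDensity
      fun x ↦ ENNReal.ofReal (riemannianJacobian φ x)).map φ := by
  -- Countably many domains that are contained in a chart of `M` and are mapped into a chart of `N`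
  -- cover `M`.
  let U : M → Set M := fun x ↦ (chartAt (EuclideanSpace ℝ (Fin n)) x).source ∩
    φ ⁻¹' (chartAt (EuclideanSpace ℝ (Fin n)) (φ x)).source
  have hUo : ∀ x, IsOpen (U x) := fun x ↦ (chartAt _ x).open_source.inter
    ((chartAt _ (φ x)).open_source.preimage φ.continuous)
  obtain ⟨t, htc, ht⟩ := TopologicalSpace.countable_cover_nhds fun x ↦
    (hUo x).mem_nhds ⟨mem_chart_source _ x, mem_chart_source _ (φ x)⟩
  have := htc.to_subtype
  have hcover : ⋃ x : t, φ.symm ⁻¹' U x = univ := by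
    rw [← preimage_iUnion, iUnion_coe_set, ht, preimage_univ]
  refine (Measure.ext_iff_of_iUnion_eq_univ hcover).mpr fun ⟨x, _⟩ ↦ ?_
  ext B hB
  have hUB : MeasurableSet (φ.symm ⁻¹' U x) :=
    ((hUo x).preimage φ.symm.continuous).measurableSet
  have hA : MeasurableSet (φ ⁻¹' B ∩ U x) :=
    (φ.continuous.measurable hB).inter (hUo x).measurableSet
  have hpre : φ ⁻¹' (B ∩ φ.symm ⁻¹' U x) = φ ⁻¹' B ∩ U x := by
    ext z; simp
  have himg : B ∩ φ.symm ⁻¹' U x = φ '' (φ ⁻¹' B ∩ U x) := by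
    rw [← hpre, image_preimage_eq (f := φ) _ φ.surjective]
  rw [Measure.restrict_apply hB, Measure.restrict_apply hB,
    Measure.map_apply φ.continuous.measurable (hB.inter hUB), hpre, withDensity_apply _ hA, himg,
    riemannianVolume_restrict_of_subset x hA fun z hz ↦ hz.2.1,
    riemannianVolume_apply_of_subset (φ x) (himg ▸ hB.inter hUB) (by
      rintro _ ⟨z, hz, rfl⟩; exact hz.2.2)]
  exact chartVolume_image φ x (φ x) hA (fun z hz ↦ hz.2.1) fun z hz ↦ hz.2.2

end Volume

/-! ### Pointwise estimates for the pushforward -/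

section Pointwise

variable {n : ℕ} {M : Type*} [TopologicalSpace M]
  [ChartedSpace (EuclideanSpace ℝ (Fin n)) M]
  {N : Type*} [TopologicalSpace N] [ChartedSpace (EuclideanSpace ℝ (Fin n)) N]

theorem mfderiv_symm_mfderiv_apply (φ : M ≃ₘ⟮𝓡 n, 𝓡 n⟯ N) (x : M) (v : TangentSpace (𝓡 n) x) :
    (mfderiv (𝓡 n) (𝓡 n) φ.symm (φ x) (mfderiv (𝓡 n) (𝓡 n) φ x v) : EuclideanSpace ℝ (Fin n)) =
      v := by
  have h := mfderiv_comp (I := 𝓡 n) (I' := 𝓡 n) (I'' := 𝓡 n) x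
    (φ.symm.mdifferentiable (by simp) (φ x)) (φ.mdifferentiable (by simp) x)
  have h1 : φ.symm ∘ φ = id := funext φ.symm_apply_apply
  rw [h1, mfderiv_id] at h
  exact (congrArg (fun L : EuclideanSpace ℝ (Fin n) →L[ℝ] EuclideanSpace ℝ (Fin n) ↦ L v) h).symm

/-- Pulling back the pushforward gives back the form, `φ^* φ_* η = η`. -/
theorem KForm.pushforward_compContinuousLinearMap_mfderiv {k : ℕ} (φ : M ≃ₘ⟮𝓡 n, 𝓡 n⟯ N)
    (η : KForm n k M) (x : M) :
    (η.pushforward φ (φ x)).compContinuousLinearMap (mfderiv (𝓡 n) (𝓡 n) φ x) = η x := by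
  -- The point `φ.symm (φ x)` is equal to `x`, but not definitionally so; `p` stands for it.
  have key : ∀ (p : M) (_ : p = x) (A : TangentSpace (𝓡 n) x →L[ℝ] TangentSpace (𝓡 n) p)
      (_ : ∀ v : TangentSpace (𝓡 n) x, (A v : EuclideanSpace ℝ (Fin n)) = v),
      (η p).compContinuousLinearMap A = η x := by
    rintro p rfl A hA
    have : A = ContinuousLinearMap.id ℝ _ := by
      ext1 v
      exact hA v
    subst this
    ext X
    rfl
  exact key (φ.symm (φ x)) (φ.symm_apply_apply x)
    ((mfderiv (𝓡 n) (𝓡 n) φ.symm (φ x)).comp (mfderiv (𝓡 n) (𝓡 n) φ x))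
    (mfderiv_symm_mfderiv_apply φ x)

variable [RiemannianBundle (fun x : M ↦ TangentSpace (𝓡 n) x)]
  [RiemannianBundle (fun x : N ↦ TangentSpace (𝓡 n) x)]

theorem singularValue_nonneg (φ : M ≃ₘ⟮𝓡 n, 𝓡 n⟯ N) (x : M) (i : ℕ) : 0 ≤ singularValue φ x i :=
  LinearMap.singularValues_nonneg _ i

theorem singularValue_pos (φ : M ≃ₘ⟮𝓡 n, 𝓡 n⟯ N) (x : M) {i : ℕ} (hi : i < n) :
    0 < singularValue φ x i := by
  have h := (φ.mfderivToContinuousLinearEquiv (by simp) x).injective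
  refine (LinearMap.injective_iff_forall_lt_finrank_singularValues_pos
    (mfderiv (𝓡 n) (𝓡 n) φ x).toLinearMap).mp h i ?_
  rwa [finrank_tangentSpace]

theorem KForm.spectralNorm_le_prod_mul_spectralNorm_pushforward {k : ℕ}
    (φ : M ≃ₘ⟮𝓡 n, 𝓡 n⟯ N) (η : KForm n k M) (x : M) :
    η.spectralNorm x ≤
      (∏ i ∈ Finset.range k, singularValue φ x i) * (η.pushforward φ).spectralNorm (φ x) := by
  have h := norm_compContinuousLinearMap_le_prod_singularValues (mfderiv (𝓡 n) (𝓡 n) φ x)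
    (finrank_tangentSpace x) (η.pushforward φ (φ x))
  rwa [η.pushforward_compContinuousLinearMap_mfderiv] at h

theorem KForm.spectralNorm_pushforward_le {k : ℕ} (hk : k ≤ n)
    (φ : M ≃ₘ⟮𝓡 n, 𝓡 n⟯ N) (η : KForm n k M) (x : M) :
    (η.pushforward φ).spectralNorm (φ x) ≤
      (∏ i ∈ Finset.Ico (n - k) n, singularValue φ x i)⁻¹ * η.spectralNorm x := by
  let T := φ.mfderivToContinuousLinearEquiv (by simp) x
  have h := norm_compContinuousLinearMap_symm_le_prod_singularValues T
    (finrank_tangentSpace x) hk (η x)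
  have h2 : (η x).compContinuousLinearMap (T.symm : TangentSpace (𝓡 n) (φ x) →L[ℝ] _) =
      η.pushforward φ (φ x) := by
    rw [← η.pushforward_compContinuousLinearMap_mfderiv φ x]
    ext X
    exact congrArg (η.pushforward φ (φ x)) (funext fun i ↦ T.apply_symm_apply (X i))
  rw [h2] at h
  exact h

/-- The inverse of the tangent map and the tangent map of `φ.symm` have codomains `T_x M` and
`T_{φ.symm (φ x)} M`, which carry the norms of two propositionally equal points. -/
theorem norm_mfderivToContinuousLinearEquiv_symm (φ : M ≃ₘ⟮𝓡 n, 𝓡 n⟯ N) (x : M) :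
    ‖((φ.mfderivToContinuousLinearEquiv (by simp) x).symm :
      TangentSpace (𝓡 n) (φ x) →L[ℝ] TangentSpace (𝓡 n) x)‖ =
      ‖mfderiv (𝓡 n) (𝓡 n) φ.symm (φ x)‖ := by
  let T := φ.mfderivToContinuousLinearEquiv (by simp) x
  -- The point `φ.symm (φ x)` is equal to `x`, but not definitionally so; `p` stands for it.
  have key : ∀ (p : M) (_ : p = x) (A : TangentSpace (𝓡 n) (φ x) →L[ℝ] TangentSpace (𝓡 n) p)
      (_ : ∀ v : TangentSpace (𝓡 n) x, (A (T v) : EuclideanSpace ℝ (Fin n)) = v),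
      ‖(T.symm : TangentSpace (𝓡 n) (φ x) →L[ℝ] TangentSpace (𝓡 n) x)‖ = ‖A‖ := by
    rintro p rfl A hA
    congr 1
    ext1 w
    obtain ⟨v, rfl⟩ := T.surjective w
    exact (T.symm_apply_apply v).trans (hA v).symm
  exact key _ (φ.symm_apply_apply x) _ (mfderiv_symm_mfderiv_apply φ x)

end Pointwise

/-! ### Local bounds on the singular values -/

section LocalBound

variable {n : ℕ} {M : Type*} [TopologicalSpace M]
  [ChartedSpace (EuclideanSpace ℝ (Fin n)) M] [IsManifold (𝓡 n) ∞ M]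
  [RiemannianBundle (fun x : M ↦ TangentSpace (𝓡 n) x)]
  [IsContMDiffRiemannianBundle (𝓡 n) ∞ (EuclideanSpace ℝ (Fin n))
    (fun x : M ↦ TangentSpace (𝓡 n) x)]
  {N : Type*} [TopologicalSpace N]
  [ChartedSpace (EuclideanSpace ℝ (Fin n)) N] [IsManifold (𝓡 n) ∞ N]
  [RiemannianBundle (fun x : N ↦ TangentSpace (𝓡 n) x)]
  [IsContMDiffRiemannianBundle (𝓡 n) ∞ (EuclideanSpace ℝ (Fin n))
    (fun x : N ↦ TangentSpace (𝓡 n) x)]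

/-- The tangent map is locally bounded: in the trivializations of the tangent bundles it is
continuous, and the trivializations are locally bounded. -/
theorem eventually_norm_mfderiv_le (φ : M ≃ₘ⟮𝓡 n, 𝓡 n⟯ N) (x₀ : M) :
    ∃ C : ℝ, ∀ᶠ x in 𝓝 x₀, ‖mfderiv (𝓡 n) (𝓡 n) φ x‖ ≤ C := by
  have := isContinuousRiemannianBundle_tangentSpace (n := n) (M := M)
  have := isContinuousRiemannianBundle_tangentSpace (n := n) (M := N)
  obtain ⟨C₁, hC₁, h₁⟩ := eventually_norm_trivializationAt_lt (EuclideanSpace ℝ (Fin n))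
    (fun x : M ↦ TangentSpace (𝓡 n) x) x₀
  obtain ⟨C₂, hC₂, h₂⟩ := eventually_norm_symmL_trivializationAt_lt (EuclideanSpace ℝ (Fin n))
    (fun x : N ↦ TangentSpace (𝓡 n) x) (φ x₀)
  have hc := ((φ.contMDiffAt (x := x₀)).mfderiv_const (m := 0) (by simp)).continuousAt
  set L := inTangentCoordinates (𝓡 n) (𝓡 n) id φ (mfderiv (𝓡 n) (𝓡 n) φ) x₀ with hL
  have h₃ : ∀ᶠ x in 𝓝 x₀, ‖L x‖ < ‖L x₀‖ + 1 :=
    hc.norm.eventually (gt_mem_nhds (lt_add_one _))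
  set e := trivializationAt (EuclideanSpace ℝ (Fin n)) (fun x : M ↦ TangentSpace (𝓡 n) x) x₀
  set e' := trivializationAt (EuclideanSpace ℝ (Fin n)) (fun x : N ↦ TangentSpace (𝓡 n) x) (φ x₀)
  have h₄ : ∀ᶠ x in 𝓝 x₀, x ∈ e.baseSet :=
    e.open_baseSet.mem_nhds (FiberBundle.mem_baseSet_trivializationAt' x₀)
  have h₅ : ∀ᶠ x in 𝓝 x₀, φ x ∈ e'.baseSet := φ.continuous.continuousAt.eventually
    (e'.open_baseSet.mem_nhds (FiberBundle.mem_baseSet_trivializationAt' (φ x₀)))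
  refine ⟨C₂ * ((‖L x₀‖ + 1) * C₁), ?_⟩
  filter_upwards [h₁, φ.continuous.continuousAt.eventually h₂, h₃, h₄, h₅] with x h₁ h₂ h₃ h₄ h₅
  have heq : mfderiv (𝓡 n) (𝓡 n) φ x =
      (e'.symmL ℝ (φ x)) ∘L ((L x) ∘L (e.continuousLinearMapAt ℝ x)) := by
    ext1 v
    simp only [ContinuousLinearMap.comp_apply, hL, inTangentCoordinates,
      ContinuousLinearMap.inCoordinates]
    erw [e'.symmL_continuousLinearMapAt h₅, e.symmL_continuousLinearMapAt h₄]
  rw [heq]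
  refine (ContinuousLinearMap.opNorm_comp_le _ _).trans ?_
  gcongr
  refine (ContinuousLinearMap.opNorm_comp_le _ _).trans ?_
  gcongr

theorem exists_singularValue_bound (φ : M ≃ₘ⟮𝓡 n, 𝓡 n⟯ N) {K : Set M} (hK : IsCompact K) :
    ∃ B : ℝ, ∀ x ∈ K, ∀ i, singularValue φ x i ≤ B ∧ (singularValue φ x i)⁻¹ ≤ B := by
  refine hK.induction_on (p := fun K ↦ ∃ B : ℝ, ∀ x ∈ K, ∀ i,
    singularValue φ x i ≤ B ∧ (singularValue φ x i)⁻¹ ≤ B) ⟨0, by simp⟩ ?_ ?_ ?_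
  · rintro s t hst ⟨B, hB⟩
    exact ⟨B, fun x hx ↦ hB x (hst hx)⟩
  · rintro s t ⟨B, hB⟩ ⟨B', hB'⟩
    refine ⟨max B B', fun x hx i ↦ ?_⟩
    rcases hx with hx | hx
    · exact ⟨(hB x hx i).1.trans (le_max_left _ _), (hB x hx i).2.trans (le_max_left _ _)⟩
    · exact ⟨(hB' x hx i).1.trans (le_max_right _ _), (hB' x hx i).2.trans (le_max_right _ _)⟩
  · intro x₀ _
    obtain ⟨C, hC⟩ := eventually_norm_mfderiv_le φ x₀
    obtain ⟨C', hC'⟩ := eventually_norm_mfderiv_le φ.symm (φ x₀)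
    refine ⟨_, mem_nhdsWithin_of_mem_nhds (hC.and (φ.continuous.continuousAt.eventually hC')),
      max C C', fun x hx i ↦ ⟨?_, ?_⟩⟩
    · exact (singularValues_le_opNorm _ i).trans (hx.1.trans (le_max_left _ _))
    · refine (inv_singularValues_le_opNorm_symm
        (φ.mfderivToContinuousLinearEquiv (by simp) x) i).trans ?_
      rw [norm_mfderivToContinuousLinearEquiv_symm]
      exact hx.2.trans (le_max_right _ _)

end LocalBound

/-! ### Estimates of `L^p` norms -/

section Lp

/-- A density `J` can be moved into the function, with exponent `1 / p`. For `p = ∞` the exponent is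
`0`, and the two measures have the same null sets because `J` is positive. No measurability of `g`
is needed. -/
theorem eLpNorm_withDensity_ofReal {X : Type*} [MeasurableSpace X] {μ : Measure X} {J : X → ℝ}
    (hJ : Measurable J) (hpos : ∀ x, 0 < J x) (g : X → ℝ) {p : ℝ≥0∞} (hp : 1 ≤ p) :
    eLpNorm g p (μ.withDensity fun x ↦ ENNReal.ofReal (J x)) =
      eLpNorm (fun x ↦ J x ^ (1 / p).toReal * g x) p μ := by
  have hJ' : Measurable fun x ↦ ENNReal.ofReal (J x) := hJ.ennreal_ofReal
  by_cases htop : p = ⊤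
  · subst htop
    simp only [eLpNorm_exponent_top, ENNReal.div_top, ENNReal.toReal_zero, Real.rpow_zero, one_mul]
    refine le_antisymm (eLpNormEssSup_mono_measure _ (withDensity_absolutelyContinuous _ _))
      (eLpNormEssSup_mono_measure _ (withDensity_absolutelyContinuous' hJ'.aemeasurable ?_))
    exact Filter.Eventually.of_forall fun x ↦ by simpa using hpos x
  · have hp0 : p ≠ 0 := (zero_lt_one.trans_le hp).ne'
    have hpr : 0 < p.toReal := ENNReal.toReal_pos hp0 htop
    rw [eLpNorm_eq_lintegral_rpow_enorm_toReal hp0 htop,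
      eLpNorm_eq_lintegral_rpow_enorm_toReal hp0 htop,
      lintegral_withDensity_eq_lintegral_mul_non_measurable _ hJ'
        (Filter.Eventually.of_forall fun x ↦ ENNReal.ofReal_lt_top)]
    congr 1
    refine lintegral_congr fun x ↦ ?_
    have h1 : ‖J x ^ (1 / p).toReal‖ₑ ^ p.toReal = ENNReal.ofReal (J x) := by
      rw [Real.enorm_of_nonneg (Real.rpow_nonneg (hpos x).le _),
        ENNReal.ofReal_rpow_of_pos (Real.rpow_pos_of_pos (hpos x) _), ← Real.rpow_mul (hpos x).le,
        ENNReal.toReal_div, ENNReal.toReal_one, one_div, inv_mul_cancel₀ hpr.ne', Real.rpow_one]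
    rw [enorm_mul, ENNReal.mul_rpow_of_nonneg _ _ hpr.le, h1]
    rfl

variable {n : ℕ} {M : Type*} [TopologicalSpace M]
  [ChartedSpace (EuclideanSpace ℝ (Fin n)) M] [IsManifold (𝓡 n) ∞ M]
  [RiemannianBundle (fun x : M ↦ TangentSpace (𝓡 n) x)]
  [IsContMDiffRiemannianBundle (𝓡 n) ∞ (EuclideanSpace ℝ (Fin n))
    (fun x : M ↦ TangentSpace (𝓡 n) x)]
  [MeasurableSpace M] [BorelSpace M] [SecondCountableTopology M]
  {N : Type*} [TopologicalSpace N]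
  [ChartedSpace (EuclideanSpace ℝ (Fin n)) N] [IsManifold (𝓡 n) ∞ N]
  [RiemannianBundle (fun x : N ↦ TangentSpace (𝓡 n) x)]
  [IsContMDiffRiemannianBundle (𝓡 n) ∞ (EuclideanSpace ℝ (Fin n))
    (fun x : N ↦ TangentSpace (𝓡 n) x)]
  [MeasurableSpace N] [BorelSpace N]

/-- The `L^p` norm of a function on `N`, computed on `M`. -/
theorem eLpNorm_riemannianVolume_eq (φ : M ≃ₘ⟮𝓡 n, 𝓡 n⟯ N) (g : N → ℝ) {p : ℝ≥0∞} (hp : 1 ≤ p) :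
    eLpNorm g p (riemannianVolume n N) =
      eLpNorm (fun x ↦ riemannianJacobian φ x ^ (1 / p).toReal * g (φ x)) p
        (riemannianVolume n M) := by
  have hφ : MeasurableEmbedding φ := φ.toHomeomorph.measurableEmbedding
  rw [riemannianVolume_eq_map_withDensity φ, hφ.eLpNorm_map_measure,
    eLpNorm_withDensity_ofReal (continuous_riemannianJacobian φ).measurable
      (riemannianJacobian_pos φ) _ hp]
  rfl

omit [IsManifold (𝓡 n) ∞ M] [IsContMDiffRiemannianBundle (𝓡 n) ∞ (EuclideanSpace ℝ (Fin n))
    (fun x : M ↦ TangentSpace (𝓡 n) x)] [BorelSpace M] [SecondCountableTopology M] in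
/-- A pointwise bound `|F| ≤ f |G|` on `s`, outside of which `F` vanishes, integrates to a bound of
the `L^p` norms. Finiteness of the supremum of `f` is needed because `F` and `G` are not assumed to
be measurable. -/
theorem eLpNorm_le_supNormOn_mul {s : Set M} {f F G : M → ℝ}
    (hfin : supNormOn n s f ≠ ⊤) (hF : ∀ x ∉ s, F x = 0) (hFG : ∀ x ∈ s, |F x| ≤ f x * |G x|)
    (p : ℝ≥0∞) :
    eLpNorm F p (riemannianVolume n M) ≤
      supNormOn n s f * eLpNorm G p (riemannianVolume n M) := by
  have h : ∀ᵐ x ∂(riemannianVolume n M), ‖F x‖ₑ ≤ (supNormOn n s f).toNNReal * ‖G x‖ₑ := by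
    have hae : ∀ᵐ x ∂(riemannianVolume n M), ‖s.indicator f x‖ₑ ≤ supNormOn n s f := by
      rw [supNormOn, eLpNorm_exponent_top]
      exact enorm_ae_le_eLpNormEssSup _ _
    filter_upwards [hae] with x hx
    rw [ENNReal.coe_toNNReal hfin]
    by_cases hxs : x ∈ s
    · rw [indicator_of_mem hxs] at hx
      refine le_trans ?_ (mul_le_mul_left hx _)
      rw [← enorm_mul, enorm_le_iff_norm_le, Real.norm_eq_abs, Real.norm_eq_abs, abs_mul]
      exact (hFG x hxs).trans (mul_le_mul_of_nonneg_right (le_abs_self _) (abs_nonneg _))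
    · simp [hF x hxs]
  have h2 := eLpNorm_le_nnreal_smul_eLpNorm_of_ae_le_mul' h p
  rwa [ENNReal.smul_def, smul_eq_mul, ENNReal.coe_toNNReal hfin] at h2

omit [SecondCountableTopology M] [BorelSpace M] [MeasurableSpace N] [BorelSpace N] in
/-- The weights in the estimates are bounded on compact sets. -/
theorem supNormOn_prod_singularValue_ne_top (φ : M ≃ₘ⟮𝓡 n, 𝓡 n⟯ N) {K : Set M}
    (hK : IsCompact K) (s t : Finset ℕ) {a b : ℝ} (ha : 0 ≤ a) (hb : 0 ≤ b) :
    supNormOn n K (fun x ↦ (∏ i ∈ s, singularValue φ x i) ^ a *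
      (∏ i ∈ t, singularValue φ x i) ^ (-b)) ≠ ⊤ := by
  obtain ⟨B, hB⟩ := exists_singularValue_bound φ hK
  have hbound : ∀ x, ‖K.indicator (fun x ↦ (∏ i ∈ s, singularValue φ x i) ^ a *
      (∏ i ∈ t, singularValue φ x i) ^ (-b)) x‖ ≤ |(B ^ s.card) ^ a * (B ^ t.card) ^ b| := by
    intro x
    by_cases hx : x ∈ K
    · rw [indicator_of_mem hx, Real.norm_eq_abs]
      have hα := fun i ↦ singularValue_nonneg φ x i
      have hB0 : 0 ≤ B := (hα 0).trans (hB x hx 0).1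
      have hs : ∏ i ∈ s, singularValue φ x i ≤ B ^ s.card :=
        (Finset.prod_le_prod (fun i _ ↦ hα i) fun i _ ↦ (hB x hx i).1).trans_eq
          (Finset.prod_const B)
      have ht : ∏ i ∈ t, (singularValue φ x i)⁻¹ ≤ B ^ t.card :=
        (Finset.prod_le_prod (fun i _ ↦ inv_nonneg.mpr (hα i)) fun i _ ↦ (hB x hx i).2).trans_eq
          (Finset.prod_const B)
      have hs0 : 0 ≤ ∏ i ∈ s, singularValue φ x i := Finset.prod_nonneg fun i _ ↦ hα i
      have ht0 : 0 ≤ ∏ i ∈ t, singularValue φ x i := Finset.prod_nonneg fun i _ ↦ hα i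
      rw [Finset.prod_inv_distrib] at ht
      rw [Real.rpow_neg ht0, ← Real.inv_rpow ht0]
      refine abs_le_abs_of_nonneg (by positivity) ?_
      gcongr
    · rw [indicator_of_notMem hx, norm_zero]
      positivity
  rw [supNormOn, eLpNorm_exponent_top]
  exact (eLpNormEssSup_lt_top_of_ae_bound (Filter.Eventually.of_forall hbound)).ne

end Lp

theorem KForm.spectralNorm_eq_zero_of_notMem_support {n k : ℕ} {M : Type*} [TopologicalSpace M]
    [ChartedSpace (EuclideanSpace ℝ (Fin n)) M]
    [RiemannianBundle (fun x : M ↦ TangentSpace (𝓡 n) x)] {η : KForm n k M} {x : M}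
    (hx : x ∉ η.support) : η.spectralNorm x = 0 := by
  have h : η x = 0 := by
    by_contra h
    exact hx (subset_closure h)
  exact (congrArg norm h).trans (norm_zero (E := TangentSpace (𝓡 n) x [⋀^Fin k]→L[ℝ] ℝ))

end

theorem mainTheorem1 (n : ℕ)
    {M : Type*} [TopologicalSpace M] [T2Space M] [SecondCountableTopology M]
    [ChartedSpace (EuclideanSpace ℝ (Fin n)) M] [IsManifold (𝓡 n) ∞ M]
    [RiemannianBundle (fun x : M ↦ TangentSpace (𝓡 n) x)]
    [IsContMDiffRiemannianBundle (𝓡 n) ∞ (EuclideanSpace ℝ (Fin n))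
      (fun x : M ↦ TangentSpace (𝓡 n) x)]
    [MeasurableSpace M] [BorelSpace M] (oM : ManifoldOrientation n M)
    {N : Type*} [TopologicalSpace N] [T2Space N] [SecondCountableTopology N]
    [ChartedSpace (EuclideanSpace ℝ (Fin n)) N] [IsManifold (𝓡 n) ∞ N]
    [RiemannianBundle (fun y : N ↦ TangentSpace (𝓡 n) y)]
    [IsContMDiffRiemannianBundle (𝓡 n) ∞ (EuclideanSpace ℝ (Fin n))
      (fun y : N ↦ TangentSpace (𝓡 n) y)]
    [MeasurableSpace N] [BorelSpace N] (oN : ManifoldOrientation n N)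
    (φ : M ≃ₘ⟮𝓡 n, 𝓡 n⟯ N) (hφ : IsOrientationPreserving oM oN φ)
    (k : ℕ) (hk : k ≤ n) (η : KForm n k M) (hη : η.IsSmooth) (hc : IsCompact η.support)
    (p q : ℝ≥0∞) (hp : 1 ≤ p) (hq : 1 ≤ q) (hpq : 1 / p + 1 / q = 1) :
    (supNormOn n η.support fun x ↦
        (∏ i ∈ Finset.range k, singularValue φ x i) ^ (1 / q).toReal *
          (∏ i ∈ Finset.Ico k n, singularValue φ x i) ^ (-(1 / p).toReal))⁻¹ * η.lpNorm p
      ≤ (η.pushforward φ).lpNorm p ∧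
    (η.pushforward φ).lpNorm p
      ≤ (supNormOn n η.support fun x ↦
          (∏ i ∈ Finset.range (n - k), singularValue φ x i) ^ (1 / p).toReal *
            (∏ i ∈ Finset.Ico (n - k) n, singularValue φ x i) ^ (-(1 / q).toReal)) *
        η.lpNorm p := by
  have hpq' : (1 / p).toReal + (1 / q).toReal = 1 := by
    have hfin : ∀ r : ℝ≥0∞, 1 ≤ r → 1 / r ≠ ⊤ := fun r hr ↦
      ENNReal.div_ne_top ENNReal.one_ne_top (zero_lt_one.trans_le hr).ne'
    rw [← ENNReal.toReal_add (hfin p hp) (hfin q hq), hpq, ENNReal.toReal_one]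
  set a := (1 / p).toReal with ha
  set b := (1 / q).toReal with hb
  have ha0 : 0 ≤ a := ENNReal.toReal_nonneg
  have hb0 : 0 ≤ b := ENNReal.toReal_nonneg
  have hprod : ∀ (m : ℕ) (_ : m ≤ n) (x : M), riemannianJacobian φ x =
      (∏ i ∈ Finset.range m, singularValue φ x i) * ∏ i ∈ Finset.Ico m n, singularValue φ x i :=
    fun m hm x ↦ by
      rw [riemannianJacobian_eq_prod_singularValue, Finset.prod_range_mul_prod_Ico _ hm]
  have hpos₁ : ∀ (m : ℕ) (_ : m ≤ n) (x : M), 0 < ∏ i ∈ Finset.range m, singularValue φ x i :=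
    fun m hm x ↦ Finset.prod_pos fun i hi ↦
      singularValue_pos φ x ((Finset.mem_range.mp hi).trans_le hm)
  have hpos₂ : ∀ (m : ℕ) (x : M), 0 < ∏ i ∈ Finset.Ico m n, singularValue φ x i :=
    fun m x ↦ Finset.prod_pos fun i hi ↦ singularValue_pos φ x (Finset.mem_Ico.mp hi).2
  -- The norm of the pushforward is computed on `M`, where the Jacobian enters with exponent `1/p`.
  have hpush : (η.pushforward φ).lpNorm p = eLpNorm
      (fun x ↦ riemannianJacobian φ x ^ a * (η.pushforward φ).spectralNorm (φ x)) p
        (riemannianVolume n M) := eLpNorm_riemannianVolume_eq φ _ hp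
  have hJ := fun x ↦ Real.rpow_nonneg (riemannianJacobian_pos φ x).le a
  have hn₁ : ∀ x, 0 ≤ η.spectralNorm x := fun x ↦ norm_nonneg (η x)
  have hn₂ : ∀ x, 0 ≤ (η.pushforward φ).spectralNorm (φ x) := fun x ↦
    norm_nonneg (η.pushforward φ (φ x))
  rw [hpush]
  constructor
  · have key : η.lpNorm p ≤ _ := eLpNorm_le_supNormOn_mul (n := n)
      (supNormOn_prod_singularValue_ne_top φ hc (Finset.range k) (Finset.Ico k n) hb0 ha0)
      (fun x hx ↦ KForm.spectralNorm_eq_zero_of_notMem_support hx)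
      (G := fun x ↦ riemannianJacobian φ x ^ a * (η.pushforward φ).spectralNorm (φ x))
      (fun x _ ↦ ?_) p
    -- `c⁻¹ * c ≤ 1` holds in `ℝ≥0∞` also for `c = 0`, where `c⁻¹ = ∞`.
    · refine (mul_le_mul_right key _).trans ?_
      rw [← mul_assoc]
      exact mul_le_of_le_one_left' (ENNReal.inv_mul_le_one _)
    · rw [abs_of_nonneg (hn₁ x), abs_of_nonneg (mul_nonneg (hJ x) (hn₂ x))]
      refine (η.spectralNorm_le_prod_mul_spectralNorm_pushforward φ x).trans_eq ?_
      have h₁ := hpos₁ k hk x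
      have h₂ := hpos₂ k x
      rw [hprod k hk, Real.mul_rpow h₁.le h₂.le, Real.rpow_neg h₂.le]
      have h₃ : (∏ i ∈ Finset.range k, singularValue φ x i) ^ b *
          (∏ i ∈ Finset.range k, singularValue φ x i) ^ a =
          ∏ i ∈ Finset.range k, singularValue φ x i := by
        rw [← Real.rpow_add h₁, add_comm, hpq', Real.rpow_one]
      have h₄ := (Real.rpow_pos_of_pos h₂ a).ne'
      conv_lhs => rw [← h₃]
      field_simp
  · refine eLpNorm_le_supNormOn_mul (n := n)
      (supNormOn_prod_singularValue_ne_top φ hc _ _ ha0 hb0) (fun x hx ↦ ?_) (fun x _ ↦ ?_) p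
    · have h := η.spectralNorm_pushforward_le hk φ x
      rw [KForm.spectralNorm_eq_zero_of_notMem_support hx, mul_zero] at h
      rw [le_antisymm h (hn₂ x), mul_zero]
    · rw [abs_of_nonneg (mul_nonneg (hJ x) (hn₂ x)), abs_of_nonneg (hn₁ x)]
      refine (mul_le_mul_of_nonneg_left (η.spectralNorm_pushforward_le hk φ x) (hJ x)).trans_eq ?_
      have h₁ := hpos₁ (n - k) (n.sub_le k) x
      have h₂ := hpos₂ (n - k) x
      rw [hprod (n - k) (n.sub_le k), Real.mul_rpow h₁.le h₂.le, Real.rpow_neg h₂.le]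
      have h₃ : (∏ i ∈ Finset.Ico (n - k) n, singularValue φ x i) ^ a *
          (∏ i ∈ Finset.Ico (n - k) n, singularValue φ x i) ^ b =
          ∏ i ∈ Finset.Ico (n - k) n, singularValue φ x i := by
        rw [← Real.rpow_add h₂, hpq', Real.rpow_one]
      have h₄ : (∏ i ∈ Finset.Ico (n - k) n, singularValue φ x i) ^ a *
          (∏ i ∈ Finset.Ico (n - k) n, singularValue φ x i)⁻¹ =
          ((∏ i ∈ Finset.Ico (n - k) n, singularValue φ x i) ^ b)⁻¹ := by
        refine eq_inv_of_mul_eq_one_left ?_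
        rw [mul_right_comm, h₃, mul_inv_cancel₀ h₂.ne']
      linear_combination (∏ i ∈ Finset.range (n - k), singularValue φ x i) ^ a *
        η.spectralNorm x * h₄
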